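/- Let $G$ be a finite group and let $T$ be a $G$-Tambara functor, with restrictions $\mathrm{res}$, transfers $\mathrm{tr}$, norms $\mathrm{nm}$ and conjugations $c_g$. An ideal $I$ of $T$ is a collection of ideals $I(G/H)\subseteq T(G/H)$, one for each subgroup $H\le G$, closed under all transfers, norms, restrictions and conjugations. The product $IJ$ of two ideals is the smallest ideal of $T$ containing $I(G/H)J(G/H)$ for every $H\le G$. An ideal $\mathfrak p$ of $T$ is (Nakaoka) prime if it is proper and, for all ideals $I,J$ of $T$, $IJ\subseteq\mathfrak p$ implies $I\subseteq\mathfrak p$ or $J\subseteq\mathfrak p$. If $G$ acts by ring homomorphisms on a commutative ring $R$, an ideal $\mathfrak q$ of $R$ is $G$-prime if it is $G$-invariant, $\mathfrak q\neq R$, and for all $x,y\in R$, if $x(g\cdot y)\in\mathfrak q$ for all $g\in G$, then $x\in\mathfrak q$ or $y\in\mathfrak q$. Theorem. (1) Every prime ideal $\mathfrak p$ of $T$ is levelwise radical: for every subgroup $H\le G$, $\mathfrak p(G/H)$ is a radical ideal of $T(G/H)$. (2) For every prime ideal $\mathfrak p$ of $T$, the ideal $\mathfrak p(G/e)$ of $T(G/e)$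 is $G$-prime, where $G$ acts on $T(G/e)$ by the conjugations $c_g$. (3) For every commutative ring $R$ on which $G$ acts by ring homomorphisms, every $G$-prime ideal of $R$ is radical. -/

import Mathlib

open scoped Pointwise

universe u v w

/-- A finite `G`-set. -/
structure FinGSet (G : Type u) [Group G] where
  carrier : Type u
  [action : MulAction G carrier]
  [finite : Finite carrier]

namespace FinGSet

variable {G : Type u} [Group G]

instance : CoeSort (FinGSet G) (Type u) := ⟨FinGSet.carrier⟩

instance (X : FinGSet G) : MulAction G X := X.action

instance (X : FinGSet G) : Finite X := X.finite

/-- The disjoint union of two finite `G`-sets. -/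
def sum (X Y : FinGSet G) : FinGSet G := ⟨X ⊕ Y⟩

/-- The inclusion of the first summand. -/
def inl (X Y : FinGSet G) : X →[G] X.sum Y where
  toFun := Sum.inl
  map_smul' _ _ := rfl

/-- The inclusion of the second summand. -/
def inr (X Y : FinGSet G) : Y →[G] X.sum Y where
  toFun := Sum.inr
  map_smul' _ _ := rfl

/-- The sub-`G`-set of `X` cut out by a `G`-invariant predicate. -/
def sub (X : FinGSet G) (p : X → Prop) (hp : ∀ (g : G) (x : X), p x → p (g • x)) :
    FinGSet G where
  carrier := {x : X // p x}
  action :=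
    { smul := fun g x => ⟨g • x.1, hp g x.1 x.2⟩
      one_smul := fun x => Subtype.ext (one_smul G x.1)
      mul_smul := fun g h x => Subtype.ext (mul_smul g h x.1) }

/-- The transitive `G`-set `G/H`. -/
def orbit [Finite G] (H : Subgroup G) : FinGSet G := ⟨G ⧸ H⟩

/-- The equivariant map `G/H → G/K` with `eH ↦ gK`, which exists when `g⁻¹Hg ≤ K`. -/
def orbitMap [Finite G] {H K : Subgroup G} (g : G) (hg : ∀ x ∈ H, g⁻¹ * x * g ∈ K) :
    orbit H →[G] orbit K where
  toFun := Quotient.map' (fun x : G => x * g) (fun a b hab => by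
    rw [QuotientGroup.leftRel_apply] at hab ⊢
    have := hg _ hab
    simpa [mul_assoc] using this)
  map_smul' g' x := by
    refine Quotient.inductionOn' x fun y => ?_
    exact congrArg (fun z : G => (QuotientGroup.mk z : G ⧸ K)) (mul_assoc g' y g)

/-- The projection `q : G/H → G/K`, `eH ↦ eK`, for `H ≤ K`. -/
def proj [Finite G] {H K : Subgroup G} (h : H ≤ K) : orbit H →[G] orbit K :=
  orbitMap 1 (fun x hx => by simpa using h hx)

/-- The equivariant bijection `c_g : G/gHg⁻¹ → G/H` with `e(gHg⁻¹) ↦ gH`. -/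
def conjMap [Finite G] (H : Subgroup G) (g : G) :
    orbit (MulAut.conj g • H) →[G] orbit H :=
  orbitMap g (fun x hx => by
    rw [Subgroup.mem_pointwise_smul_iff_inv_smul_mem] at hx
    simpa [← map_inv] using hx)

/-- The square of finite `G`-sets
```
X' --a--> X
|f'       |f
v         v
Y' --b--> Y
```
is a pullback square. -/
def IsPullbackSquare {X' X Y' Y : FinGSet G} (a : X' →[G] X) (f' : X' →[G] Y')
    (f : X →[G] Y) (b : Y' →[G] Y) : Prop :=
  (∀ z, f (a z) = b (f' z)) ∧ ∀ x y, f x = b y → ∃! z, a z = x ∧ f' z = y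

section Exponential

variable {A X Y : FinGSet G}

/-- The dependent product `Π_f A` of `p : A → X` along `f : X → Y`. Its points over `y` are the
sections of `p` over the fibre `f⁻¹(y)`; a section is recorded by its image, a subset `S` of `A`
which `p` maps bijectively onto `f⁻¹(y)`. The group acts by `g • (y, S) = (g • y, g • S)`. -/
def depProd (p : A →[G] X) (f : X →[G] Y) : FinGSet G :=
  sub ⟨Y × Set A⟩ (fun z => Set.BijOn p z.2 (f ⁻¹' {z.1})) (by
    rintro g ⟨y, S⟩ ⟨h1, h2, h3⟩
    refine ⟨?_, ?_, ?_⟩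
    · rintro _ ⟨a, ha, rfl⟩
      have := h1 ha
      simp only [Set.mem_preimage, Set.mem_singleton_iff] at this
      simp [this]
    · rintro _ ⟨a, ha, rfl⟩ _ ⟨b, hb, rfl⟩ hab
      simp only [map_smul, smul_left_cancel_iff] at hab
      exact congrArg (fun c => g • c) (h2 ha hb hab)
    · intro x hx
      have hx' : g⁻¹ • x ∈ f ⁻¹' {y} := by
        simp only [Set.mem_preimage, Set.mem_singleton_iff] at hx ⊢
        rw [map_smul, hx]
        exact inv_smul_smul g y
      obtain ⟨a, ha, hax⟩ := h3 hx'
      refine ⟨g • a, ⟨a, ha, rfl⟩, ?_⟩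
      rw [map_smul, hax, smul_inv_smul])

/-- The structure map `Π_f A → Y`. -/
def depProdMap (p : A →[G] X) (f : X →[G] Y) : depProd p f →[G] Y where
  toFun z := z.1.1
  map_smul' _ _ := rfl

/-- The pullback `X ×_Y Π_f A`. A point `(x, (y, S))` of it is recorded as `(a, (y, S))`, where `a`
is the value at `x` of the section `S`, that is, the unique element of `S` over `x`. -/
def depEval (p : A →[G] X) (f : X →[G] Y) : FinGSet G :=
  sub ⟨A × depProd p f⟩ (fun z => z.1 ∈ z.2.1.2)
    (fun _ _ hz => Set.smul_mem_smul_set hz)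

/-- The evaluation map `X ×_Y Π_f A → A`. -/
def evalMap (p : A →[G] X) (f : X →[G] Y) : depEval p f →[G] A where
  toFun z := z.1.1
  map_smul' _ _ := rfl

/-- The projection `X ×_Y Π_f A → Π_f A`. -/
def evalProj (p : A →[G] X) (f : X →[G] Y) : depEval p f →[G] depProd p f where
  toFun z := z.1.2
  map_smul' _ _ := rfl

end Exponential

end FinGSet

open FinGSet

/-- A `G`-Tambara functor: commutative rings `T(X)` for all finite `G`-sets `X`, with restrictions
`R_f`, transfers `T_f` and norms `N_f` along all equivariant maps, such that `T` takes disjoint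
unions to products, the three kinds of maps are functorial, transfers and norms satisfy base change
along pullback squares, and norms distribute over transfers along exponential diagrams. -/
structure TambaraFunctor (G : Type u) [Group G] where
  obj : FinGSet G → Type v
  [ring : ∀ X, CommRing (obj X)]
  R : ∀ {X Y : FinGSet G}, (X →[G] Y) → (obj Y →+* obj X)
  T : ∀ {X Y : FinGSet G}, (X →[G] Y) → (obj X →+ obj Y)
  N : ∀ {X Y : FinGSet G}, (X →[G] Y) → (obj X →* obj Y)
  subsingleton_of_isEmpty : ∀ X : FinGSet G, IsEmpty X → Subsingleton (obj X)
  bijective_sum : ∀ X Y : FinGSet G,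
    Function.Bijective (fun t : obj (X.sum Y) => (R (inl X Y) t, R (inr X Y) t))
  R_id : ∀ (X : FinGSet G) (t : obj X), R (MulActionHom.id G) t = t
  T_id : ∀ (X : FinGSet G) (t : obj X), T (MulActionHom.id G) t = t
  N_id : ∀ (X : FinGSet G) (t : obj X), N (MulActionHom.id G) t = t
  R_comp : ∀ {X Y Z : FinGSet G} (g : Y →[G] Z) (f : X →[G] Y) (t : obj Z),
    R (g.comp f) t = R f (R g t)
  T_comp : ∀ {X Y Z : FinGSet G} (g : Y →[G] Z) (f : X →[G] Y) (t : obj X),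
    T (g.comp f) t = T g (T f t)
  N_comp : ∀ {X Y Z : FinGSet G} (g : Y →[G] Z) (f : X →[G] Y) (t : obj X),
    N (g.comp f) t = N g (N f t)
  R_T : ∀ {X' X Y' Y : FinGSet G} (a : X' →[G] X) (f' : X' →[G] Y') (f : X →[G] Y)
    (b : Y' →[G] Y), IsPullbackSquare a f' f b → ∀ t : obj X, R b (T f t) = T f' (R a t)
  R_N : ∀ {X' X Y' Y : FinGSet G} (a : X' →[G] X) (f' : X' →[G] Y') (f : X →[G] Y)
    (b : Y' →[G] Y), IsPullbackSquare a f' f b → ∀ t : obj X, R b (N f t) = N f' (R a t)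
  N_T : ∀ {A X Y : FinGSet G} (p : A →[G] X) (f : X →[G] Y) (t : obj A),
    N f (T p t) = T (depProdMap p f) (N (evalProj p f) (R (evalMap p f) t))

namespace TambaraFunctor

variable {G : Type u} [Group G]

instance (F : TambaraFunctor.{u, v} G) (X : FinGSet G) : CommRing (F.obj X) := F.ring X

variable [Finite G] (F : TambaraFunctor.{u, v} G)

/-- The ring `T(G/H)`. -/
abbrev level (H : Subgroup G) : Type v := F.obj (orbit H)

/-- The restriction `T(G/K) → T(G/H)` for `H ≤ K`. -/
def res {H K : Subgroup G} (h : H ≤ K) : F.level K →+* F.level H := F.R (proj h)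

/-- The transfer `T(G/H) → T(G/K)` for `H ≤ K`. -/
def tr {H K : Subgroup G} (h : H ≤ K) : F.level H →+ F.level K := F.T (proj h)

/-- The norm `T(G/H) → T(G/K)` for `H ≤ K`. -/
def nm {H K : Subgroup G} (h : H ≤ K) : F.level H →* F.level K := F.N (proj h)

/-- The conjugation `T(G/H) → T(G/gHg⁻¹)`. -/
def conj (H : Subgroup G) (g : G) : F.level H →+* F.level (MulAut.conj g • H) :=
  F.R (conjMap H g)

/-- The equivariant map `G/e → G/e`, `x ↦ xg`. -/
def rightMul (g : G) : orbit (⊥ : Subgroup G) →[G] orbit (⊥ : Subgroup G) :=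
  orbitMap g (fun x hx => by
    rw [Subgroup.mem_bot] at hx ⊢
    simp [hx])

/-- The action of `G` on the underlying ring `T(G/e)` by the conjugations (under the identification
of the trivial subgroup with its conjugates). -/
instance underlyingAction : MulSemiringAction G (F.level ⊥) where
  smul g x := F.R (rightMul g) x
  one_smul x := by
    have h : rightMul (1 : G) = MulActionHom.id G := by
      ext z
      refine Quotient.inductionOn' z fun y => ?_
      exact congrArg (fun z : G => (QuotientGroup.mk z : G ⧸ (⊥ : Subgroup G))) (mul_one y)
    change F.R (rightMul 1) x = x
    rw [h, F.R_id]
  mul_smul g h x := by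
    have e : rightMul (g * h) = (rightMul h).comp (rightMul g) := by
      ext z
      refine Quotient.inductionOn' z fun y => ?_
      exact congrArg (fun z : G => (QuotientGroup.mk z : G ⧸ (⊥ : Subgroup G)))
        (mul_assoc y g h).symm
    change F.R (rightMul (g * h)) x = F.R (rightMul g) (F.R (rightMul h) x)
    rw [e, F.R_comp]
  smul_zero g := map_zero (F.R (rightMul g))
  smul_add g := map_add (F.R (rightMul g))
  smul_one g := map_one (F.R (rightMul g))
  smul_mul g := map_mul (F.R (rightMul g))

end TambaraFunctor

/-- An ideal of a Tambara functor: a levelwise collection of ideals closed under transfers, norms,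
restrictions and conjugations. -/
structure TambaraIdeal {G : Type u} [Group G] [Finite G] (F : TambaraFunctor.{u, v} G) where
  level : ∀ H : Subgroup G, Ideal (F.level H)
  tr_mem : ∀ {K H : Subgroup G} (h : K ≤ H) (x : F.level K), x ∈ level K → F.tr h x ∈ level H
  nm_mem : ∀ {K H : Subgroup G} (h : K ≤ H) (x : F.level K), x ∈ level K → F.nm h x ∈ level H
  res_mem : ∀ {K H : Subgroup G} (h : K ≤ H) (x : F.level H), x ∈ level H → F.res h x ∈ level K
  conj_mem : ∀ (H : Subgroup G) (g : G) (x : F.level H), x ∈ level H →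
    F.conj H g x ∈ level (MulAut.conj g • H)

namespace TambaraIdeal

variable {G : Type u} [Group G] [Finite G] {F : TambaraFunctor.{u, v} G}

/-- Levelwise inclusion of ideals. -/
instance : LE (TambaraIdeal F) := ⟨fun I J => ∀ H, I.level H ≤ J.level H⟩

/-- The ideal generated by a levelwise collection of subsets: the intersection of all ideals that
contain it. -/
def span (S : ∀ H : Subgroup G, Set (F.level H)) : TambaraIdeal F where
  level H := ⨅ (I : TambaraIdeal F) (_ : ∀ L, S L ⊆ I.level L), I.level H
  tr_mem h x hx := by
    simp only [Submodule.mem_iInf] at hx ⊢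
    exact fun I hI => I.tr_mem h x (hx I hI)
  nm_mem h x hx := by
    simp only [Submodule.mem_iInf] at hx ⊢
    exact fun I hI => I.nm_mem h x (hx I hI)
  res_mem h x hx := by
    simp only [Submodule.mem_iInf] at hx ⊢
    exact fun I hI => I.res_mem h x (hx I hI)
  conj_mem H g x hx := by
    simp only [Submodule.mem_iInf] at hx ⊢
    exact fun I hI => I.conj_mem H g x (hx I hI)

/-- The product `IJ`: the ideal generated by the levelwise products `I(G/H)J(G/H)`. -/
instance : Mul (TambaraIdeal F) :=
  ⟨fun I J => span fun H => ((I.level H * J.level H : Ideal (F.level H)) : Set (F.level H))⟩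

/-- Prime ideals of a Tambara functor, in the sense of Nakaoka. -/
def IsPrime (P : TambaraIdeal F) : Prop :=
  (∃ H : Subgroup G, P.level H ≠ ⊤) ∧
    ∀ I J : TambaraIdeal F, I * J ≤ P → I ≤ P ∨ J ≤ P

end TambaraIdeal

/-- `G`-prime ideals of a commutative ring on which `G` acts by ring homomorphisms. -/
def IsGPrime (G : Type u) [Group G] {R : Type w} [CommRing R] [MulSemiringAction G R]
    (I : Ideal R) : Prop :=
  (∀ (g : G) (x : R), x ∈ I → g • x ∈ I) ∧ I ≠ ⊤ ∧
    ∀ x y : R, (∀ g : G, x * (g • y) ∈ I) → x ∈ I ∨ y ∈ I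

namespace FinGSet

variable {G : Type u} [Group G]

@[elab_as_elim]
theorem sum_cases {X Y : FinGSet G} {motive : X.sum Y → Prop}
    (hl : ∀ x, motive (inl X Y x)) (hr : ∀ y, motive (inr X Y y)) (z : X.sum Y) : motive z := by
  rcases z with x | y
  · exact hl x
  · exact hr y

theorem inl_injective (X Y : FinGSet G) : Function.Injective (inl X Y) :=
  fun _ _ h => Sum.inl_injective h

theorem inr_injective (X Y : FinGSet G) : Function.Injective (inr X Y) :=
  fun _ _ h => Sum.inr_injective h

theorem inl_ne_inr {X Y : FinGSet G} (x : X) (y : Y) : inl X Y x ≠ inr X Y y :=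
  fun h => Sum.inl_ne_inr h

/-- The map out of a disjoint union given by maps out of the two summands. -/
def sumElim {X Y Z : FinGSet G} (f : X →[G] Z) (g : Y →[G] Z) : X.sum Y →[G] Z where
  toFun := Sum.elim f g
  map_smul' m z := by
    rcases z with x | y
    · exact map_smul f m x
    · exact map_smul g m y

@[simp] theorem sumElim_inl {X Y Z : FinGSet G} (f : X →[G] Z) (g : Y →[G] Z) (x : X) :
    sumElim f g (inl X Y x) = f x := rfl

@[simp] theorem sumElim_inr {X Y Z : FinGSet G} (f : X →[G] Z) (g : Y →[G] Z) (y : Y) :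
    sumElim f g (inr X Y y) = g y := rfl

@[simp] theorem sumElim_comp_inl {X Y Z : FinGSet G} (f : X →[G] Z) (g : Y →[G] Z) :
    (sumElim f g).comp (inl X Y) = f := by
  ext x; rfl

@[simp] theorem sumElim_comp_inr {X Y Z : FinGSet G} (f : X →[G] Z) (g : Y →[G] Z) :
    (sumElim f g).comp (inr X Y) = g := by
  ext x; rfl

/-- The disjoint union of two equivariant maps. -/
def sumMap {X Y X' Y' : FinGSet G} (f : X →[G] X') (g : Y →[G] Y') :
    X.sum Y →[G] X'.sum Y' :=
  sumElim ((inl X' Y').comp f) ((inr X' Y').comp g)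

theorem isPullbackSquare_inl_sumMap {X Y X' Y' : FinGSet G} (f : X →[G] X') (g : Y →[G] Y') :
    IsPullbackSquare (inl X Y) f (sumMap f g) (inl X' Y') := by
  refine ⟨fun _ => rfl, fun z y => ?_⟩
  induction z using sum_cases with
  | hl x =>
    intro h
    exact ⟨x, ⟨rfl, inl_injective _ _ h⟩, fun z hz => inl_injective _ _ hz.1⟩
  | hr x => exact fun h => absurd h.symm (inl_ne_inr _ _)

theorem isPullbackSquare_inr_sumMap {X Y X' Y' : FinGSet G} (f : X →[G] X') (g : Y →[G] Y') :
    IsPullbackSquare (inr X Y) g (sumMap f g) (inr X' Y') := by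
  refine ⟨fun _ => rfl, fun z y => ?_⟩
  induction z using sum_cases with
  | hl x => exact fun h => absurd h (inl_ne_inr _ _)
  | hr x =>
    intro h
    exact ⟨x, ⟨rfl, inr_injective _ _ h⟩, fun z hz => inr_injective _ _ hz.1⟩

theorem isPullbackSquare_of_injective {X Y : FinGSet G} (f : X →[G] Y)
    (hf : Function.Injective f) :
    IsPullbackSquare (MulActionHom.id G) (MulActionHom.id G) f f := by
  refine ⟨fun _ => rfl, fun x y h => ?_⟩
  exact ⟨x, ⟨rfl, hf h⟩, fun z hz => hz.1⟩

theorem isPullbackSquare_of_bijective {X Y : FinGSet G} (f : X →[G] Y)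
    (hf : Function.Bijective f) :
    IsPullbackSquare f f (MulActionHom.id G) (MulActionHom.id G) := by
  refine ⟨fun _ => rfl, fun x y h => ?_⟩
  obtain ⟨z, hz⟩ := hf.2 x
  exact ⟨z, ⟨hz, hz.trans h⟩, fun z' hz' => hf.1 (hz'.1.trans hz.symm)⟩

/-- The empty `G`-set. -/
def empty (G : Type u) [Group G] : FinGSet G where
  carrier := PEmpty
  action :=
    { smul := fun _ x => x
      one_smul := fun x => x.elim
      mul_smul := fun _ _ x => x.elim }

instance : IsEmpty (empty G) := inferInstanceAs (IsEmpty PEmpty)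

/-- The unique map out of an empty `G`-set. -/
def ofIsEmpty (X Y : FinGSet G) [IsEmpty X] : X →[G] Y where
  toFun := isEmptyElim
  map_smul' _ x := isEmptyElim x

theorem isPullbackSquare_inl_inr (X Y : FinGSet G) :
    IsPullbackSquare (ofIsEmpty (empty G) X) (ofIsEmpty (empty G) Y) (inl X Y) (inr X Y) :=
  ⟨fun z => isEmptyElim z, fun _ _ h => absurd h (inl_ne_inr _ _)⟩

theorem isPullbackSquare_inr_inl (X Y : FinGSet G) :
    IsPullbackSquare (ofIsEmpty (empty G) Y) (ofIsEmpty (empty G) X) (inr X Y) (inl X Y) :=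
  ⟨fun z => isEmptyElim z, fun _ _ h => absurd h.symm (inl_ne_inr _ _)⟩

section FiberProd

variable {X Y Z : FinGSet G} (f : X →[G] Z) (g : Y →[G] Z)

/-- The fibre product of two equivariant maps. -/
def fiberProd : FinGSet G :=
  sub ⟨X × Y⟩ (fun z => f z.1 = g z.2) (fun m z hz =>
    (map_smul f m z.1).trans ((congrArg (m • ·) hz).trans (map_smul g m z.2).symm))

/-- The first projection of a fibre product. -/
def fiberProdFst : fiberProd f g →[G] X where
  toFun z := z.1.1
  map_smul' _ _ := rfl

/-- The second projection of a fibre product. -/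
def fiberProdSnd : fiberProd f g →[G] Y where
  toFun z := z.1.2
  map_smul' _ _ := rfl

theorem isPullbackSquare_fiberProd :
    IsPullbackSquare (fiberProdFst f g) (fiberProdSnd f g) f g :=
  ⟨fun z => z.2, fun x y h => ⟨⟨(x, y), h⟩, ⟨rfl, rfl⟩, fun _ hz =>
    Subtype.ext (Prod.ext hz.1 hz.2)⟩⟩

end FiberProd

theorem evalProj_surjective {A X Y : FinGSet G} (p : A →[G] X) (f : X →[G] Y)
    (hf : Function.Surjective f) : Function.Surjective (evalProj p f) := by
  intro z
  obtain ⟨x, hx⟩ := hf z.1.1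
  obtain ⟨a, ha, -⟩ := z.2.2.2 (show x ∈ f ⁻¹' {z.1.1} from hx)
  exact ⟨⟨(a, z), ha⟩, rfl⟩

/-- All fibres of `f` have at least `k` points. -/
def FibersAtLeast (k : ℕ) {X Y : FinGSet G} (f : X →[G] Y) : Prop :=
  ∀ y, ∃ s : Fin k → X, Function.Injective s ∧ ∀ i, f (s i) = y

namespace FibersAtLeast

variable {k l : ℕ} {X Y Z : FinGSet G}

theorem of_isEmpty {f : X →[G] Y} [IsEmpty Y] : FibersAtLeast k f := fun y => isEmptyElim y

theorem one_of_surjective {f : X →[G] Y} (hf : Function.Surjective f) : FibersAtLeast 1 f := by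
  intro y
  obtain ⟨x, hx⟩ := hf y
  exact ⟨fun _ => x, fun _ _ _ => Subsingleton.elim _ _, fun _ => hx⟩

theorem comp {f : X →[G] Y} (h : FibersAtLeast k f) {g : Y →[G] Z}
    (hg : Function.Surjective g) : FibersAtLeast k (g.comp f) := by
  intro z
  obtain ⟨y, rfl⟩ := hg z
  obtain ⟨s, hs, hy⟩ := h y
  exact ⟨s, hs, fun i => congrArg g (hy i)⟩

theorem fiberProdSnd {f : X →[G] Z} (h : FibersAtLeast k f) (g : Y →[G] Z) :
    FibersAtLeast k (fiberProdSnd f g) := by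
  intro y
  obtain ⟨s, hs, hy⟩ := h (g y)
  refine ⟨fun i => ⟨(s i, y), hy i⟩, fun i j hij => hs ?_, fun _ => rfl⟩
  exact congrArg (FinGSet.fiberProdFst f g) hij

theorem sumMap {X' Y' : FinGSet G} {f : X →[G] Y} (hf : FibersAtLeast k f) {f' : X' →[G] Y'}
    (hf' : FibersAtLeast k f') : FibersAtLeast k (sumMap f f') := by
  intro z
  induction z using sum_cases with
  | hl y =>
    obtain ⟨s, hs, hy⟩ := hf y
    exact ⟨fun i => inl _ _ (s i), (inl_injective _ _).comp hs,
      fun i => congrArg (inl Y Y') (hy i)⟩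
  | hr y =>
    obtain ⟨s, hs, hy⟩ := hf' y
    exact ⟨fun i => inr _ _ (s i), (inr_injective _ _).comp hs,
      fun i => congrArg (inr Y Y') (hy i)⟩

theorem sumElim {f : X →[G] Z} (hf : FibersAtLeast k f) {g : Y →[G] Z}
    (hg : FibersAtLeast l g) : FibersAtLeast (k + l) (sumElim f g) := by
  intro z
  obtain ⟨s, hs, hsz⟩ := hf z
  obtain ⟨t, ht, htz⟩ := hg z
  refine ⟨Sum.elim (inl X Y ∘ s) (inr X Y ∘ t) ∘ finSumFinEquiv.symm,
    (((inl_injective X Y).comp hs).sumElim ((inr_injective X Y).comp ht)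
      fun _ _ => inl_ne_inr _ _).comp finSumFinEquiv.symm.injective, fun i => ?_⟩
  obtain ⟨j, rfl⟩ := finSumFinEquiv.surjective i
  rcases j with j | j
  · simpa using hsz j
  · simpa using htz j

theorem le_card [Nonempty Y] {f : X →[G] Y} (hf : FibersAtLeast k f) : k ≤ Nat.card X := by
  obtain ⟨s, hs, -⟩ := hf (Classical.arbitrary Y)
  simpa using Nat.card_le_card_of_injective s hs

end FibersAtLeast

section Induction

variable [Finite G]

/-- The orbit map `G/H → X` at a point fixed by `H`. -/
def ofFixed {X : FinGSet G} (H : Subgroup G) (x : X) (hx : ∀ h ∈ H, h • x = x) :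
    orbit H →[G] X where
  toFun := Quotient.lift (fun g : G => g • x) (fun a b hab => by
    have := hx _ (QuotientGroup.leftRel_apply.1 hab)
    rw [mul_smul, inv_smul_eq_iff] at this
    exact this.symm)
  map_smul' m z := by
    refine Quotient.inductionOn' z fun y => ?_
    exact mul_smul m y x

/-- Induction on finite `G`-sets, by their decomposition into orbits. -/
theorem induction {motive : FinGSet G → Prop}
    (empty : ∀ X : FinGSet G, IsEmpty X → motive X)
    (orbit : ∀ H : Subgroup G, motive (orbit H))
    (sum : ∀ X Y : FinGSet G, motive X → motive Y → motive (X.sum Y))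
    (iso : ∀ (X Y : FinGSet G) (e : X →[G] Y), Function.Bijective e → motive X → motive Y)
    (X : FinGSet G) : motive X := by
  induction hn : Nat.card X using Nat.strong_induction_on generalizing X with
  | _ n ih =>
  subst hn
  rcases isEmpty_or_nonempty X with hX | ⟨⟨x⟩⟩
  · exact empty X hX
  let Y : FinGSet G := sub X (fun z => z ∉ MulAction.orbit G x)
    (fun g z hz ⟨a, ha⟩ => hz ⟨g⁻¹ * a, by
      simp only at ha ⊢
      rw [mul_smul, ha, inv_smul_smul]⟩)
  let i : Y →[G] X := ⟨fun z => z.1, fun _ _ => rfl⟩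
  let j : FinGSet.orbit (MulAction.stabilizer G x) →[G] X := ofFixed _ x (fun h hh => hh)
  refine iso _ _ (sumElim j i) ⟨?_, ?_⟩
    (sum _ _ (orbit (MulAction.stabilizer G x)) (ih (Nat.card Y) ?_ Y rfl))
  · intro a b
    induction a using sum_cases with
    | hl a =>
      refine Quotient.inductionOn' a fun a => ?_
      induction b using sum_cases with
      | hl b =>
        refine Quotient.inductionOn' b fun b h => ?_
        refine congrArg (inl _ _) (QuotientGroup.eq.2 ?_)
        rw [MulAction.mem_stabilizer_iff, mul_smul, inv_smul_eq_iff]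
        exact (show a • x = b • x from h).symm
      | hr b => exact fun h => absurd ⟨a, h⟩ b.2
    | hr a =>
      induction b using sum_cases with
      | hl b =>
        refine Quotient.inductionOn' b fun b => ?_
        exact fun h => absurd ⟨b, h.symm⟩ a.2
      | hr b => exact fun h => congrArg (inr _ _) (Subtype.ext h)
  · intro y
    by_cases hy : y ∈ MulAction.orbit G x
    · obtain ⟨g, hg⟩ := hy
      exact ⟨inl _ _ (QuotientGroup.mk g : G ⧸ MulAction.stabilizer G x), hg⟩
    · exact ⟨inr _ _ ⟨y, hy⟩, rfl⟩
  · exact Finite.card_subtype_lt (x := x) (fun h => h (MulAction.mem_orbit_self _))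

end Induction

end FinGSet

namespace FinGSet

variable {G : Type u} [Group G]

/-- The fold map. -/
def fold (Y : FinGSet G) : Y.sum Y →[G] Y := sumElim (MulActionHom.id G) (MulActionHom.id G)

section

variable {X X' Y : FinGSet G} (f : X →[G] Y) (f' : X' →[G] Y)

/-- The section over the fibre of the fold map given by a point of the fibre product. -/
def toDepProd : fiberProd f f' →[G] depProd (sumMap f f') (fold Y) where
  toFun z := ⟨(f z.1.1, {inl X X' z.1.1, inr X X' z.1.2}), by
    refine ⟨?_, ?_, ?_⟩
    · rintro a (rfl | rfl)
      · rfl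
      · exact z.2.symm
    · rintro a (rfl | rfl) b (rfl | rfl) h
      · rfl
      · exact absurd h (inl_ne_inr _ _)
      · exact absurd h.symm (inl_ne_inr _ _)
      · rfl
    · intro y hy
      induction y using sum_cases with
      | hl y =>
        exact ⟨inl X X' z.1.1, Or.inl rfl, congrArg (inl Y Y) (show y = f z.1.1 from hy).symm⟩
      | hr y =>
        exact ⟨inr X X' z.1.2, Or.inr rfl, congrArg (inr Y Y)
          (z.2.symm.trans (show y = f z.1.1 from hy).symm)⟩⟩
  map_smul' g z := by
    refine Subtype.ext (Prod.ext (map_smul f g z.1.1) ?_)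
    exact (Set.image_pair (fun a : X.sum X' => g • a) (inl X X' z.1.1) (inr X X' z.1.2)).symm

theorem toDepProd_bijective : Function.Bijective (toDepProd f f') := by
  constructor
  · rintro ⟨⟨x, x'⟩, hx⟩ ⟨⟨z, z'⟩, hz⟩ h
    have hS : ({inl X X' x, inr X X' x'} : Set (X.sum X')) = {inl X X' z, inr X X' z'} :=
      congrArg (fun d : depProd (sumMap f f') (fold Y) => d.1.2) h
    have h1 : inl X X' x ∈ ({inl X X' z, inr X X' z'} : Set (X.sum X')) := hS ▸ Or.inl rfl
    have h2 : inr X X' x' ∈ ({inl X X' z, inr X X' z'} : Set (X.sum X')) := hS ▸ Or.inr rfl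
    have e1 : x = z := h1.elim (fun h => inl_injective _ _ h) (fun h => absurd h (inl_ne_inr _ _))
    have e2 : x' = z' := h2.elim (fun h => absurd h.symm (inl_ne_inr _ _))
      (fun h => inr_injective _ _ h)
    subst e1 e2
    rfl
  · rintro ⟨⟨y, S⟩, h1, h2, h3⟩
    obtain ⟨a, haS, ha⟩ := h3 (show inl Y Y y ∈ fold Y ⁻¹' {y} from rfl)
    obtain ⟨a', haS', ha'⟩ := h3 (show inr Y Y y ∈ fold Y ⁻¹' {y} from rfl)
    induction a using sum_cases with
    | hr x => exact absurd ha.symm (inl_ne_inr _ _)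
    | hl x =>
    induction a' using sum_cases with
    | hl x => exact absurd ha' (inl_ne_inr _ _)
    | hr x' =>
    have hx : f x = y := inl_injective _ _ ha
    have hx' : f' x' = y := inr_injective _ _ ha'
    refine ⟨⟨(x, x'), hx.trans hx'.symm⟩, Subtype.ext (Prod.ext hx ?_)⟩
    refine Set.Subset.antisymm ?_ ?_
    · rintro b (rfl | rfl)
      · exact haS
      · exact haS'
    · intro b hb
      have hby := h1 hb
      have : sumMap f f' b = inl Y Y y ∨ sumMap f f' b = inr Y Y y := by
        generalize sumMap f f' b = c at hby
        induction c using sum_cases with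
        | hl c => exact Or.inl (congrArg (inl Y Y) hby)
        | hr c => exact Or.inr (congrArg (inr Y Y) hby)
      rcases this with h | h
      · exact Or.inl (h2 hb haS (h.trans ha.symm))
      · exact Or.inr (h2 hb haS' (h.trans ha'.symm))

/-- The two values of the section given by a point of the fibre product. -/
def toDepEval : (fiberProd f f').sum (fiberProd f f') →[G] depEval (sumMap f f') (fold Y) :=
  sumElim
    { toFun := fun z => ⟨(inl X X' z.1.1, toDepProd f f' z), Or.inl rfl⟩
      map_smul' := fun g z => Subtype.ext (Prod.ext rfl (map_smul (toDepProd f f') g z)) }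
    { toFun := fun z => ⟨(inr X X' z.1.2, toDepProd f f' z), Or.inr rfl⟩
      map_smul' := fun g z => Subtype.ext (Prod.ext rfl (map_smul (toDepProd f f') g z)) }

theorem isPullbackSquare_toDepEval :
    IsPullbackSquare (toDepEval f f') (fold _) (evalProj (sumMap f f') (fold Y))
      (toDepProd f f') := by
  refine ⟨fun z => ?_, ?_⟩
  · induction z using sum_cases with
    | hl z => rfl
    | hr z => rfl
  · rintro ⟨⟨a, d⟩, ha⟩ q (rfl : d = toDepProd f f' q)
    rcases id ha with h | h
    · obtain rfl : a = inl X X' q.1.1 := h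
      refine ⟨inl _ _ q, ⟨rfl, rfl⟩, fun z hz => ?_⟩
      induction z using sum_cases with
      | hl z => exact congrArg (inl _ _) hz.2
      | hr z =>
        exact absurd (congrArg (evalMap (sumMap f f') (fold Y)) hz.1).symm (inl_ne_inr _ _)
    · obtain rfl : a = inr X X' q.1.2 := h
      refine ⟨inr _ _ q, ⟨rfl, rfl⟩, fun z hz => ?_⟩
      induction z using sum_cases with
      | hr z => exact congrArg (inr _ _) hz.2
      | hl z => exact absurd (congrArg (evalMap (sumMap f f') (fold Y)) hz.1) (inl_ne_inr _ _)

end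

end FinGSet

namespace TambaraFunctor

variable {G : Type u} [Group G] (F : TambaraFunctor.{u, v} G)

theorem T_R_of_bijective {X Y : FinGSet G} (e : X →[G] Y) (he : Function.Bijective e)
    (t : F.obj Y) : F.T e (F.R e t) = t := by
  rw [← F.R_T _ _ _ _ (isPullbackSquare_of_bijective e he), F.T_id, F.R_id]

theorem N_R_of_bijective {X Y : FinGSet G} (e : X →[G] Y) (he : Function.Bijective e)
    (t : F.obj Y) : F.N e (F.R e t) = t := by
  rw [← F.R_N _ _ _ _ (isPullbackSquare_of_bijective e he), F.N_id, F.R_id]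

theorem T_comp_R_of_bijective {X Y Z : FinGSet G} (e : X →[G] Y) (he : Function.Bijective e)
    (f : Y →[G] Z) (t : F.obj Y) : F.T (f.comp e) (F.R e t) = F.T f t := by
  rw [F.T_comp, F.T_R_of_bijective e he]

theorem N_comp_R_of_bijective {X Y Z : FinGSet G} (e : X →[G] Y) (he : Function.Bijective e)
    (f : Y →[G] Z) (t : F.obj Y) : F.N (f.comp e) (F.R e t) = F.N f t := by
  rw [F.N_comp, F.N_R_of_bijective e he]

variable {F} in
theorem sum_ext {X Y : FinGSet G} {s t : F.obj (X.sum Y)}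
    (hl : F.R (inl X Y) s = F.R (inl X Y) t) (hr : F.R (inr X Y) s = F.R (inr X Y) t) : s = t :=
  (F.bijective_sum X Y).1 (Prod.ext hl hr)

theorem exists_sum {X Y : FinGSet G} (a : F.obj X) (b : F.obj Y) :
    ∃ t : F.obj (X.sum Y), F.R (inl X Y) t = a ∧ F.R (inr X Y) t = b := by
  obtain ⟨t, ht⟩ := (F.bijective_sum X Y).2 (a, b)
  exact ⟨t, congrArg Prod.fst ht, congrArg Prod.snd ht⟩

theorem eq_of_isEmpty {X : FinGSet G} [IsEmpty X] (s t : F.obj X) : s = t :=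
  (F.subsingleton_of_isEmpty X inferInstance).elim s t

theorem R_T_of_injective {X Y : FinGSet G} (f : X →[G] Y) (hf : Function.Injective f)
    (t : F.obj X) : F.R f (F.T f t) = t := by
  rw [F.R_T _ _ _ _ (isPullbackSquare_of_injective f hf), F.R_id, F.T_id]

theorem R_N_of_injective {X Y : FinGSet G} (f : X →[G] Y) (hf : Function.Injective f)
    (t : F.obj X) : F.R f (F.N f t) = t := by
  rw [F.R_N _ _ _ _ (isPullbackSquare_of_injective f hf), F.R_id, F.N_id]

theorem T_sum {X Y Z : FinGSet G} (h : X.sum Y →[G] Z) (t : F.obj (X.sum Y)) :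
    F.T h t = F.T (h.comp (inl X Y)) (F.R (inl X Y) t) +
      F.T (h.comp (inr X Y)) (F.R (inr X Y) t) := by
  rw [F.T_comp, F.T_comp, ← map_add]
  congr 1
  apply sum_ext
  · rw [map_add, F.R_T_of_injective _ (inl_injective X Y),
      F.R_T _ _ _ _ (isPullbackSquare_inr_inl X Y), F.eq_of_isEmpty (F.R _ (F.R _ t)) 0, map_zero,
      add_zero]
  · rw [map_add, F.R_T_of_injective _ (inr_injective X Y),
      F.R_T _ _ _ _ (isPullbackSquare_inl_inr X Y), F.eq_of_isEmpty (F.R _ (F.R _ t)) 0, map_zero,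
      zero_add]

theorem N_sum {X Y Z : FinGSet G} (h : X.sum Y →[G] Z) (t : F.obj (X.sum Y)) :
    F.N h t = F.N (h.comp (inl X Y)) (F.R (inl X Y) t) *
      F.N (h.comp (inr X Y)) (F.R (inr X Y) t) := by
  rw [F.N_comp, F.N_comp, ← map_mul]
  congr 1
  apply sum_ext
  · rw [map_mul, F.R_N_of_injective _ (inl_injective X Y),
      F.R_N _ _ _ _ (isPullbackSquare_inr_inl X Y), F.eq_of_isEmpty (F.R _ (F.R _ t)) 1, map_one,
      mul_one]
  · rw [map_mul, F.R_N_of_injective _ (inr_injective X Y),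
      F.R_N _ _ _ _ (isPullbackSquare_inl_inr X Y), F.eq_of_isEmpty (F.R _ (F.R _ t)) 1, map_one,
      one_mul]

theorem N_fold {Y : FinGSet G} (t : F.obj (Y.sum Y)) :
    F.N (fold Y) t = F.R (inl Y Y) t * F.R (inr Y Y) t := by
  rw [F.N_sum, fold, sumElim_comp_inl, sumElim_comp_inr, F.N_id, F.N_id]

theorem T_of_isEmpty {X Y : FinGSet G} [IsEmpty X] (f : X →[G] Y) (t : F.obj X) :
    F.T f t = 0 := by
  rw [F.eq_of_isEmpty t 0, map_zero]

/-- The product of two transfers. -/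
theorem T_mul_T {X X' Y : FinGSet G} (f : X →[G] Y) (f' : X' →[G] Y) (b : F.obj X)
    (b' : F.obj X') :
    F.T f b * F.T f' b' = F.T (f.comp (fiberProdFst f f'))
      (F.R (fiberProdFst f f') b * F.R (fiberProdSnd f f') b') := by
  obtain ⟨t, rfl, rfl⟩ := F.exists_sum b b'
  rw [← F.R_T _ _ _ _ (isPullbackSquare_inl_sumMap f f'),
    ← F.R_T _ _ _ _ (isPullbackSquare_inr_sumMap f f'), ← F.N_fold, F.N_T,
    ← F.T_comp_R_of_bijective _ (toDepProd_bijective f f'),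
    F.R_N _ _ _ _ (isPullbackSquare_toDepEval f f'), F.N_fold]
  simp only [← F.R_comp]
  rfl

/-- Frobenius reciprocity. -/
theorem T_mul {X Y : FinGSet G} (f : X →[G] Y) (b : F.obj X) (c : F.obj Y) :
    F.T f b * c = F.T f (b * F.R f c) := by
  have h : Function.Bijective (fiberProdFst f (MulActionHom.id G : Y →[G] Y)) := by
    constructor
    · rintro ⟨⟨x, y⟩, hx⟩ ⟨⟨x', y'⟩, hx'⟩ (rfl : x = x')
      exact Subtype.ext (Prod.ext rfl (hx.symm.trans hx'))
    · exact fun x => ⟨⟨(x, f x), rfl⟩, rfl⟩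
  have e : fiberProdSnd f (MulActionHom.id G : Y →[G] Y) = f.comp (fiberProdFst f _) := by
    ext z; exact z.2.symm
  conv_lhs => rw [← F.T_id Y c]
  rw [F.T_mul_T, e, F.R_comp, ← map_mul, F.T_comp_R_of_bijective _ h]

end TambaraFunctor

namespace TambaraFunctor

variable {G : Type u} [Group G] (F : TambaraFunctor.{u, v} G)

/-- A family of subsets whose transfers form an ideal: it is closed under multiplication by scalars,
restrictions, norms along surjections, and gluing over disjoint unions. -/
structure IsNormClosed (B : ∀ X : FinGSet G, Set (F.obj X)) : Prop where
  mem_of_isEmpty : ∀ (X : FinGSet G) [IsEmpty X] (b : F.obj X), b ∈ B X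
  mul_mem : ∀ {X : FinGSet G} (c : F.obj X) {b : F.obj X}, b ∈ B X → c * b ∈ B X
  R_mem : ∀ {X Y : FinGSet G} (f : X →[G] Y) {b : F.obj Y}, b ∈ B Y → F.R f b ∈ B X
  N_mem : ∀ {X Y : FinGSet G} (f : X →[G] Y), Function.Surjective f →
    ∀ {b : F.obj X}, b ∈ B X → F.N f b ∈ B Y
  sum_mem : ∀ {X Y : FinGSet G} {t : F.obj (X.sum Y)}, F.R (inl X Y) t ∈ B X →
    F.R (inr X Y) t ∈ B Y → t ∈ B (X.sum Y)

variable {F}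

theorem IsNormClosed.exists_T_add {B : ∀ X : FinGSet G, Set (F.obj X)} (hB : F.IsNormClosed B)
    {X X' Y : FinGSet G} (f : X →[G] Y) (f' : X' →[G] Y) {b : F.obj X} (hb : b ∈ B X)
    {b' : F.obj X'} (hb' : b' ∈ B X') :
    ∃ t ∈ B (X.sum X'), F.T (sumElim f f') t = F.T f b + F.T f' b' := by
  obtain ⟨t, rfl, rfl⟩ := F.exists_sum b b'
  refine ⟨t, hB.sum_mem hb hb', ?_⟩
  rw [F.T_sum, sumElim_comp_inl, sumElim_comp_inr]

variable [Finite G]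

theorem proj_surjective {H K : Subgroup G} (h : H ≤ K) : Function.Surjective (proj h) := by
  intro z
  refine Quotient.inductionOn' z fun y => ?_
  exact ⟨(QuotientGroup.mk y : G ⧸ H), congrArg (fun z : G => (QuotientGroup.mk z : G ⧸ K))
    (mul_one y)⟩

/-- The ideal of all transfers of elements of a norm closed family. -/
def IsNormClosed.ideal {B : ∀ X : FinGSet G, Set (F.obj X)} (hB : F.IsNormClosed B) :
    TambaraIdeal F where
  level H :=
    { carrier := {t | ∃ (X : FinGSet G) (f : X →[G] orbit H), ∃ b ∈ B X, F.T f b = t}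
      zero_mem' := ⟨empty G, ofIsEmpty _ _, 0, hB.mem_of_isEmpty _ _, map_zero _⟩
      add_mem' := by
        rintro _ _ ⟨X, f, b, hb, rfl⟩ ⟨X', f', b', hb', rfl⟩
        exact ⟨_, _, hB.exists_T_add f f' hb hb'⟩
      smul_mem' := by
        rintro c _ ⟨X, f, b, hb, rfl⟩
        refine ⟨X, f, F.R f c * b, hB.mul_mem _ hb, ?_⟩
        rw [smul_eq_mul, mul_comm c, F.T_mul, mul_comm b] }
  tr_mem := by
    rintro K H h _ ⟨X, f, b, hb, rfl⟩
    exact ⟨X, _, b, hb, F.T_comp _ _ _⟩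
  nm_mem := by
    rintro K H h _ ⟨X, f, b, hb, rfl⟩
    exact ⟨_, _, _, hB.N_mem _ (evalProj_surjective _ _ (proj_surjective h)) (hB.R_mem _ hb),
      (F.N_T _ _ _).symm⟩
  res_mem := by
    rintro K H h _ ⟨X, f, b, hb, rfl⟩
    exact ⟨_, _, _, hB.R_mem _ hb, (F.R_T _ _ _ _ (isPullbackSquare_fiberProd f _) _).symm⟩
  conj_mem := by
    rintro H g _ ⟨X, f, b, hb, rfl⟩
    exact ⟨_, _, _, hB.R_mem _ hb, (F.R_T _ _ _ _ (isPullbackSquare_fiberProd f _) _).symm⟩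

end TambaraFunctor

namespace TambaraIdeal

variable {G : Type u} [Group G] [Finite G] {F : TambaraFunctor.{u, v} G}

theorem mul_le {I J P : TambaraIdeal F}
    (h : ∀ H, ∀ a ∈ I.level H, ∀ b ∈ J.level H, a * b ∈ P.level H) : I * J ≤ P := by
  intro H
  exact iInf₂_le P fun L => Ideal.mul_le.2 fun a ha b hb => h L a ha b hb

/-- A map of orbits is right multiplication by some `g` on representatives. -/
theorem exists_orbitMap_apply {K H : Subgroup G} (f : orbit K →[G] orbit H) :
    ∃ g : G, ∀ a : G, f (QuotientGroup.mk a : G ⧸ K) = (QuotientGroup.mk (a * g) : G ⧸ H) := by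
  obtain ⟨g, hg⟩ := QuotientGroup.mk_surjective (s := H) (f (QuotientGroup.mk 1 : G ⧸ K))
  refine ⟨g, fun a => ?_⟩
  have e : (QuotientGroup.mk a : G ⧸ K) = a • (QuotientGroup.mk 1 : G ⧸ K) :=
    congrArg _ (mul_one a).symm
  rw [e]
  exact (map_smul f a _).trans (congrArg (a • ·) hg.symm)

theorem R_mem (P : TambaraIdeal F) {K H : Subgroup G} (f : orbit K →[G] orbit H) {x : F.level H}
    (hx : x ∈ P.level H) : F.R f x ∈ P.level K := by
  obtain ⟨g, hf⟩ := exists_orbitMap_apply f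
  have hK : K ≤ MulAut.conj g • H := by
    intro k hk
    rw [Subgroup.mem_pointwise_smul_iff_inv_smul_mem]
    have : (QuotientGroup.mk (1 * g) : G ⧸ H) = QuotientGroup.mk (k * g) := by
      rw [← hf, ← hf]
      exact congrArg f (QuotientGroup.eq.2 (by simpa using hk))
    have := QuotientGroup.eq.1 this
    simpa [← map_inv, mul_assoc] using this
  have e : f = (conjMap H g).comp (proj hK) := by
    ext z
    refine Quotient.inductionOn' z fun a => (hf a).trans ?_
    exact congrArg (fun z : G => (QuotientGroup.mk z : G ⧸ H))
      (congrArg (· * g) (mul_one a).symm)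
  rw [e, F.R_comp]
  exact P.res_mem hK _ (P.conj_mem H g x hx)

theorem conjMap_bijective (H : Subgroup G) (g : G) : Function.Bijective (conjMap H g) := by
  constructor
  · intro a b
    refine Quotient.inductionOn' a fun a => Quotient.inductionOn' b fun b h => ?_
    refine QuotientGroup.eq.2 ?_
    have := QuotientGroup.eq.1 (show (QuotientGroup.mk (a * g) : G ⧸ H) = QuotientGroup.mk (b * g)
      from h)
    rw [Subgroup.mem_pointwise_smul_iff_inv_smul_mem]
    simpa [← map_inv, mul_assoc] using this
  · intro z
    refine Quotient.inductionOn' z fun a => ?_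
    exact ⟨(QuotientGroup.mk (a * g⁻¹) : G ⧸ _), congrArg (fun z : G => (QuotientGroup.mk z : G ⧸ H))
      (inv_mul_cancel_right a g)⟩

/-- Up to a conjugation of the source, every map of orbits is a projection. -/
theorem exists_comp_conjMap_eq_proj {K H : Subgroup G} (f : orbit K →[G] orbit H) :
    ∃ (g : G) (h : MulAut.conj g • K ≤ H), f.comp (conjMap K g) = proj h := by
  obtain ⟨g, hf⟩ := exists_orbitMap_apply f
  refine ⟨g⁻¹, fun k hk => ?_, ?_⟩
  · rw [Subgroup.mem_pointwise_smul_iff_inv_smul_mem] at hk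
    have : (QuotientGroup.mk (1 * g) : G ⧸ H) = QuotientGroup.mk (g * k * g⁻¹ * g) := by
      rw [← hf, ← hf]
      exact congrArg f (QuotientGroup.eq.2 (by simpa [← map_inv] using hk))
    simpa [mul_assoc] using QuotientGroup.eq.1 this
  · ext z
    refine Quotient.inductionOn' z fun a => (hf (a * g⁻¹)).trans ?_
    exact congrArg (fun z : G => (QuotientGroup.mk z : G ⧸ H)) (by simp)

theorem T_mem_of_orbit (P : TambaraIdeal F) {K H : Subgroup G} (f : orbit K →[G] orbit H)
    {x : F.level K} (hx : x ∈ P.level K) : F.T f x ∈ P.level H := by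
  obtain ⟨g, h, e⟩ := exists_comp_conjMap_eq_proj f
  rw [← F.T_comp_R_of_bijective _ (conjMap_bijective K g), e]
  exact P.tr_mem h _ (P.conj_mem K g x hx)

theorem N_mem (P : TambaraIdeal F) {K H : Subgroup G} (f : orbit K →[G] orbit H)
    {x : F.level K} (hx : x ∈ P.level K) : F.N f x ∈ P.level H := by
  obtain ⟨g, h, e⟩ := exists_comp_conjMap_eq_proj f
  rw [← F.N_comp_R_of_bijective _ (conjMap_bijective K g), e]
  exact P.nm_mem h _ (P.conj_mem K g x hx)

/-- Transfers along arbitrary maps of `G`-sets preserve membership, tested on orbits. -/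
theorem T_mem (P : TambaraIdeal F) {H : Subgroup G} {X : FinGSet G} (f : X →[G] orbit H)
    {t : F.obj X} (ht : ∀ (K : Subgroup G) (i : orbit K →[G] X), F.R i t ∈ P.level K) :
    F.T f t ∈ P.level H := by
  induction X using FinGSet.induction with
  | empty X hX => rw [F.T_of_isEmpty]; exact zero_mem _
  | orbit K =>
    refine P.T_mem_of_orbit f ?_
    have := ht K (MulActionHom.id G)
    rwa [F.R_id] at this
  | sum X Y hX hY =>
    rw [F.T_sum]
    refine add_mem (hX _ fun K i => ?_) (hY _ fun K i => ?_)
    · rw [← F.R_comp]; exact ht _ _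
    · rw [← F.R_comp]; exact ht _ _
  | iso X Y e he hX =>
    rw [← F.T_comp_R_of_bijective e he]
    refine hX _ fun K i => ?_
    rw [← F.R_comp]
    exact ht _ _

end TambaraIdeal

namespace TambaraFunctor

variable {G : Type u} [Group G] {F : TambaraFunctor.{u, v} G}

/-- The multiples of the norms, along maps whose fibres have at least `k` points, of restrictions
of `x`. -/
def normMultiples (k : ℕ) {Z : FinGSet G} (x : F.obj Z) (X : FinGSet G) : Set (F.obj X) :=
  {b | ∃ (C : FinGSet G) (v : C →[G] X) (w : C →[G] Z) (c : F.obj X),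
    FibersAtLeast k v ∧ b = c * F.N v (F.R w x)}

theorem isNormClosed_normMultiples (k : ℕ) {Z : FinGSet G} (x : F.obj Z) :
    F.IsNormClosed (normMultiples k x) where
  mem_of_isEmpty X _ b :=
    ⟨empty G, ofIsEmpty _ _, ofIsEmpty _ _, 0, .of_isEmpty, F.eq_of_isEmpty _ _⟩
  mul_mem := by
    rintro X c _ ⟨C, v, w, d, hv, rfl⟩
    exact ⟨C, v, w, c * d, hv, (mul_assoc _ _ _).symm⟩
  R_mem := by
    rintro X Y f _ ⟨C, v, w, d, hv, rfl⟩
    refine ⟨_, fiberProdSnd v f, w.comp (fiberProdFst v f), F.R f d, hv.fiberProdSnd f, ?_⟩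
    rw [map_mul, F.R_N _ _ _ _ (isPullbackSquare_fiberProd v f), F.R_comp]
  N_mem := by
    rintro X Y f hf _ ⟨C, v, w, d, hv, rfl⟩
    refine ⟨C, f.comp v, w, F.N f d, hv.comp hf, ?_⟩
    rw [map_mul, F.N_comp]
  sum_mem := by
    rintro X Y t ⟨C, v, w, d, hv, h⟩ ⟨C', v', w', d', hv', h'⟩
    obtain ⟨c, rfl, rfl⟩ := F.exists_sum d d'
    refine ⟨C.sum C', sumMap v v', sumElim w w', c, hv.sumMap hv', sum_ext ?_ ?_⟩
    · rw [h, map_mul, F.R_N _ _ _ _ (isPullbackSquare_inl_sumMap v v'), ← F.R_comp,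
        sumElim_comp_inl]
    · rw [h', map_mul, F.R_N _ _ _ _ (isPullbackSquare_inr_sumMap v v'), ← F.R_comp,
        sumElim_comp_inr]

theorem mul_mem_normMultiples {k l : ℕ} {Z : FinGSet G} {x : F.obj Z} {X : FinGSet G}
    {a b : F.obj X} (ha : a ∈ normMultiples k x X) (hb : b ∈ normMultiples l x X) :
    a * b ∈ normMultiples (k + l) x X := by
  obtain ⟨C, v, w, c, hv, rfl⟩ := ha
  obtain ⟨C', v', w', c', hv', rfl⟩ := hb
  refine ⟨C.sum C', sumElim v v', sumElim w w', c * c', hv.sumElim hv', ?_⟩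
  rw [F.N_sum, sumElim_comp_inl, sumElim_comp_inr, ← F.R_comp, ← F.R_comp, sumElim_comp_inl,
    sumElim_comp_inr]
  ring

variable [Finite G]

/-- The ideal of the transfers of `normMultiples k x`; for `k = 1` it is generated by `x`. -/
def powIdeal (k : ℕ) {Z : FinGSet G} (x : F.obj Z) : TambaraIdeal F :=
  (isNormClosed_normMultiples k x).ideal

theorem mem_powIdeal_one {H : Subgroup G} (x : F.level H) : x ∈ (powIdeal 1 x).level H := by
  refine ⟨orbit H, MulActionHom.id G, x, ⟨orbit H, MulActionHom.id G, MulActionHom.id G, 1,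
    .one_of_surjective Function.surjective_id, ?_⟩, F.T_id _ _⟩
  rw [one_mul, F.N_id, F.R_id]

theorem powIdeal_mul_le (k l : ℕ) {Z : FinGSet G} (x : F.obj Z) :
    powIdeal k x * powIdeal l x ≤ powIdeal (k + l) x := by
  refine TambaraIdeal.mul_le ?_
  rintro H _ ⟨X, f, b, hb, rfl⟩ _ ⟨X', f', b', hb', rfl⟩
  rw [F.T_mul_T]
  exact ⟨_, _, _, mul_mem_normMultiples ((isNormClosed_normMultiples k x).R_mem _ hb)
    ((isNormClosed_normMultiples l x).R_mem _ hb'), rfl⟩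

theorem powIdeal_le {k : ℕ} {Z : FinGSet G} {x : F.obj Z} {P : TambaraIdeal F}
    (h : ∀ K : Subgroup G, normMultiples k x (orbit K) ⊆ P.level K) : powIdeal k x ≤ P := by
  rintro H _ ⟨X, f, b, hb, rfl⟩
  exact P.T_mem f fun K i => h K ((isNormClosed_normMultiples k x).R_mem i hb)

theorem powIdeal_mul_powIdeal_le {k l : ℕ} {Z W : FinGSet G} {x : F.obj Z} {y : F.obj W}
    {P : TambaraIdeal F} (h : ∀ K : Subgroup G, ∀ a ∈ normMultiples k x (orbit K),
      ∀ b ∈ normMultiples l y (orbit K), a * b ∈ P.level K) : powIdeal k x * powIdeal l y ≤ P := by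
  refine TambaraIdeal.mul_le ?_
  rintro H _ ⟨X, f, b, hb, rfl⟩ _ ⟨X', f', b', hb', rfl⟩
  rw [F.T_mul_T]
  refine P.T_mem _ fun K i => ?_
  rw [map_mul, ← F.R_comp, ← F.R_comp]
  exact h K _ ((isNormClosed_normMultiples k x).R_mem _ hb) _
    ((isNormClosed_normMultiples l y).R_mem _ hb')

end TambaraFunctor

namespace TambaraFunctor

variable {G : Type u} [Group G] [Finite G] {F : TambaraFunctor.{u, v} G}

/-- The ideal spanned by the norms of restrictions of `x` along maps from single orbits. -/
def orbitNormIdeal {Z : FinGSet G} (x : F.obj Z) (X : FinGSet G) : Ideal (F.obj X) :=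
  Ideal.span (Set.range fun p : Σ L : Subgroup G, (orbit L →[G] X) × (orbit L →[G] Z) =>
    F.N p.2.1 (F.R p.2.2 x))

instance finite_hom (X Y : FinGSet G) : Finite (X →[G] Y) := DFunLike.finite _

theorem orbitNormIdeal_fg {Z : FinGSet G} (x : F.obj Z) (X : FinGSet G) :
    (orbitNormIdeal x X).FG :=
  Submodule.fg_span (Set.finite_range _)

theorem exists_mem_orbitNormIdeal_pow {Z : FinGSet G} (x : F.obj Z) {X C : FinGSet G}
    (v : C →[G] X) (w : C →[G] Z) :
    ∃ j, Nat.card C ≤ Nat.card G * j ∧ F.N v (F.R w x) ∈ orbitNormIdeal x X ^ j := by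
  induction C using FinGSet.induction with
  | empty C hC => exact ⟨0, by simp, by simp⟩
  | orbit L =>
    refine ⟨1, ?_, ?_⟩
    · rw [mul_one]
      exact Nat.card_le_card_of_surjective _ (QuotientGroup.mk_surjective (s := L))
    · rw [pow_one]
      exact Ideal.subset_span ⟨⟨L, v, w⟩, rfl⟩
  | sum C D hC hD =>
    obtain ⟨j, hj, hm⟩ := hC (v.comp (inl C D)) (w.comp (inl C D))
    obtain ⟨k, hk, hn⟩ := hD (v.comp (inr C D)) (w.comp (inr C D))
    refine ⟨j + k, ?_, ?_⟩
    · rw [mul_add, show Nat.card (C.sum D) = _ from Nat.card_sum (α := C) (β := D)]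
      exact add_le_add hj hk
    · rw [F.N_sum, ← F.R_comp, ← F.R_comp, pow_add]
      exact Ideal.mul_mem_mul hm hn
  | iso C D e he hC =>
    obtain ⟨j, hj, hm⟩ := hC (v.comp e) (w.comp e)
    refine ⟨j, ?_, ?_⟩
    · rwa [← Nat.card_eq_of_bijective e he]
    · rwa [F.R_comp, F.N_comp_R_of_bijective e he] at hm

theorem normMultiples_subset_orbitNormIdeal_pow {Z : FinGSet G} (x : F.obj Z) {X : FinGSet G}
    [Nonempty X] {k n : ℕ} (hk : Nat.card G * n < k + Nat.card G) :
    normMultiples k x X ⊆ ((orbitNormIdeal x X ^ n : Ideal (F.obj X)) : Set (F.obj X)) := by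
  rintro _ ⟨C, v, w, c, hv, rfl⟩
  obtain ⟨j, hj, hm⟩ := exists_mem_orbitNormIdeal_pow x v w
  refine Ideal.mul_mem_left _ c (Ideal.pow_le_pow_right ?_ hm)
  have : Nat.card G * n < Nat.card G * (j + 1) := by
    rw [mul_add, mul_one]
    exact hk.trans_le (Nat.add_le_add_right (hv.le_card.trans hj) _)
  exact Nat.lt_succ_iff.1 (lt_of_mul_lt_mul_left' this)

instance (H : Subgroup G) : Nonempty (orbit H) := ⟨(QuotientGroup.mk 1 : G ⧸ H)⟩

theorem normMultiples_one_subset_orbitNormIdeal {Z : FinGSet G} (x : F.obj Z) {X : FinGSet G}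
    [Nonempty X] : normMultiples 1 x X ⊆ orbitNormIdeal x X := by
  simpa using normMultiples_subset_orbitNormIdeal_pow x (X := X) (k := 1) (n := 1)
    (by omega)

theorem exists_powIdeal_le {H : Subgroup G} {x : F.level H} {P : TambaraIdeal F} {n : ℕ}
    (hx : x ^ n ∈ P.level H) : ∃ N, ∀ k ≥ N, powIdeal k x ≤ P := by
  have hr : ∀ K : Subgroup G, orbitNormIdeal x (orbit K) ≤ (P.level K).radical := by
    refine fun K => Ideal.span_le.2 ?_
    rintro _ ⟨⟨L, u, w⟩, rfl⟩
    refine ⟨n, ?_⟩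
    rw [← map_pow, ← map_pow]
    exact P.N_mem u (P.R_mem w hx)
  choose N hN using fun K =>
    Ideal.exists_pow_le_of_le_radical_of_fg (hr K) (orbitNormIdeal_fg x (orbit K))
  obtain ⟨M, hM⟩ := (Set.finite_range N).bddAbove
  refine ⟨Nat.card G * M, fun k hk => powIdeal_le fun K => ?_⟩
  refine (normMultiples_subset_orbitNormIdeal_pow x ?_).trans (hN K)
  have h1 : Nat.card G * N K ≤ Nat.card G * M := Nat.mul_le_mul_left _ (hM ⟨K, rfl⟩)
  have h2 : 0 < Nat.card G := Nat.card_pos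
  omega

end TambaraFunctor

namespace TambaraIdeal

open TambaraFunctor

variable {G : Type u} [Group G] [Finite G] {F : TambaraFunctor.{u, v} G} {P : TambaraIdeal F}

theorem IsPrime.isRadical (hP : P.IsPrime) (H : Subgroup G) : (P.level H).IsRadical := by
  rintro x ⟨n, hx⟩
  obtain ⟨N, hN⟩ := exists_powIdeal_le hx
  have key : ∀ i, powIdeal (2 ^ i) x ≤ P → powIdeal 1 x ≤ P := by
    intro i
    induction i with
    | zero => exact id
    | succ i ih =>
      intro h
      refine ih ((hP.2 _ _ fun K => (powIdeal_mul_le _ _ x K).trans ?_).elim id id)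
      rw [← two_mul, ← pow_succ']
      exact h K
  exact key N (hN _ N.lt_two_pow_self.le) H (mem_powIdeal_one x)

theorem eq_bot_of_hom {L : Subgroup G} (f : orbit L →[G] orbit (⊥ : Subgroup G)) : L = ⊥ := by
  obtain ⟨g, hf⟩ := exists_orbitMap_apply f
  refine (Subgroup.eq_bot_iff_forall _).2 fun l hl => ?_
  have : (QuotientGroup.mk (1 * g) : G ⧸ (⊥ : Subgroup G)) = QuotientGroup.mk (l * g) := by
    rw [← hf, ← hf]
    exact congrArg f (QuotientGroup.eq.2 (by simpa using hl))
  have := QuotientGroup.eq.1 this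
  rw [Subgroup.mem_bot, inv_mul_eq_one] at this
  exact mul_right_cancel this.symm

theorem R_eq_smul (f : orbit (⊥ : Subgroup G) →[G] orbit (⊥ : Subgroup G)) :
    ∃ g : G, ∀ x : F.level ⊥, F.R f x = g • x := by
  obtain ⟨g, hf⟩ := exists_orbitMap_apply f
  have : f = rightMul g := by
    ext z
    exact Quotient.inductionOn' z hf
  exact ⟨g, fun x => by rw [this]; rfl⟩

theorem exists_comp_rightMul_eq {K : Subgroup G} (f f' : orbit (⊥ : Subgroup G) →[G] orbit K) :
    ∃ g : G, f.comp (rightMul g) = f' := by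
  obtain ⟨a, ha⟩ := exists_orbitMap_apply f
  obtain ⟨b, hb⟩ := exists_orbitMap_apply f'
  refine ⟨b * a⁻¹, ?_⟩
  ext z
  refine Quotient.inductionOn' z fun c => (ha (c * (b * a⁻¹))).trans (.trans ?_ (hb c).symm)
  exact congrArg (fun z : G => (QuotientGroup.mk z : G ⧸ K)) (by simp [mul_assoc])

theorem rightMul_bijective (g : G) : Function.Bijective (rightMul g) := by
  constructor
  · intro a b
    refine Quotient.inductionOn' a fun a => Quotient.inductionOn' b fun b h => ?_
    refine QuotientGroup.eq.2 ?_
    have := QuotientGroup.eq.1 (show (QuotientGroup.mk (a * g) : G ⧸ (⊥ : Subgroup G)) =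
      QuotientGroup.mk (b * g) from h)
    rw [Subgroup.mem_bot, inv_mul_eq_one] at this ⊢
    exact mul_right_cancel this
  · intro z
    refine Quotient.inductionOn' z fun a => ?_
    exact ⟨(QuotientGroup.mk (a * g⁻¹) : G ⧸ _),
      congrArg (fun z : G => (QuotientGroup.mk z : G ⧸ (⊥ : Subgroup G)))
      (inv_mul_cancel_right a g)⟩

theorem smul_mem (P : TambaraIdeal F) (g : G) {x : F.level ⊥} (hx : x ∈ P.level ⊥) :
    g • x ∈ P.level ⊥ :=
  P.R_mem (rightMul g) hx

theorem IsPrime.isGPrime (hP : P.IsPrime) : IsGPrime G (P.level ⊥) := by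
  refine ⟨fun g x hx => P.smul_mem g hx, fun h => ?_, fun x y hxy => ?_⟩
  · obtain ⟨H, hH⟩ := hP.1
    refine hH ((Ideal.eq_top_iff_one _).2 ?_)
    rw [← map_one (F.nm (bot_le : ⊥ ≤ H))]
    exact P.nm_mem _ _ (h ▸ Submodule.mem_top)
  · have hle : powIdeal 1 x * powIdeal 1 y ≤ P := by
      refine powIdeal_mul_powIdeal_le fun K a ha b hb => ?_
      suffices h : orbitNormIdeal x (orbit K) * orbitNormIdeal y (orbit K) ≤ P.level K from
        h (Ideal.mul_mem_mul (normMultiples_one_subset_orbitNormIdeal x ha)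
          (normMultiples_one_subset_orbitNormIdeal y hb))
      rw [orbitNormIdeal, orbitNormIdeal, Ideal.span_mul_span, Ideal.span_le]
      rintro _ ⟨_, ⟨⟨L, u, w⟩, rfl⟩, _, ⟨⟨L', u', w'⟩, rfl⟩, rfl⟩
      obtain rfl := eq_bot_of_hom w
      obtain rfl := eq_bot_of_hom w'
      obtain ⟨c, rfl⟩ := exists_comp_rightMul_eq u' u
      obtain ⟨g, hg⟩ := R_eq_smul (F := F) w
      obtain ⟨h, hh⟩ := R_eq_smul (F := F) (w'.comp (rightMul c))
      simp only [SetLike.mem_coe]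
      rw [← F.N_comp_R_of_bijective _ (rightMul_bijective c) u', ← map_mul, ← F.R_comp, hg, hh]
      refine P.N_mem _ ?_
      have := P.smul_mem g (hxy (g⁻¹ * h))
      rwa [smul_mul', smul_smul, mul_inv_cancel_left] at this
    exact (hP.2 _ _ hle).imp (fun h => h ⊥ (mem_powIdeal_one x))
      (fun h => h ⊥ (mem_powIdeal_one y))

end TambaraIdeal

theorem IsGPrime.isRadical {G : Type u} [Group G] [Finite G] {R : Type w} [CommRing R]
    [MulSemiringAction G R] {I : Ideal R} (hI : IsGPrime G I) : I.IsRadical := by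
  rintro x ⟨n, hx⟩
  let J : Ideal R := Ideal.span (Set.range fun g : G => g • x)
  have hJ : J ≤ I.radical := by
    refine Ideal.span_le.2 ?_
    rintro _ ⟨g, rfl⟩
    refine ⟨n, ?_⟩
    simp only [← smul_pow']
    exact hI.1 g _ hx
  obtain ⟨N, hN⟩ := Ideal.exists_pow_le_of_le_radical_of_fg hJ
    (Submodule.fg_span (Set.finite_range _))
  by_contra hxI
  induction N with
  | zero => exact hI.2.1 (top_le_iff.1 (by simpa using hN))
  | succ N ih =>
    refine ih fun y hy => (hI.2.2 y x fun g => hN ?_).resolve_right hxI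
    rw [pow_succ]
    exact Ideal.mul_mem_mul hy (Ideal.subset_span ⟨g, rfl⟩)

theorem mainTheorem7 {G : Type u} [Group G] [Finite G] :
    (∀ (T : TambaraFunctor.{u, v} G) (P : TambaraIdeal T), P.IsPrime →
      (∀ H : Subgroup G, (P.level H).IsRadical) ∧ IsGPrime G (P.level ⊥)) ∧
    (∀ (R : Type w) [CommRing R] [MulSemiringAction G R] (I : Ideal R),
      IsGPrime G I → I.IsRadical) := by
  exact ⟨fun _ _ hP => ⟨hP.isRadical, hP.isGPrime⟩, fun _ _ _ _ hI => hI.isRadical⟩
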